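/- Let $n\ge 1$, let $x_1,\dots,x_n\in\mathbb R^d$ with labels $y_1,\dots,y_n\in\{-1,1\}$, put $R=\max_i\|x_i\|_2$, and let $\lambda>0$. Let the loss be $\ell(z)=\log(1+e^z)$ (logistic regression) or $\ell(z)=\max(0,1+z)$ (SVM), and let the regularizer $r$ on $\mathbb R^d$ be $\|\cdot\|_1$, $\|\cdot\|_2$ or $\|\cdot\|_2^2$. For $\beta\in\mathbb R^d$ put $$f_i(\beta)=\ell(-y_i\,\beta\cdot x_i)+\frac{\lambda\, r(R\beta)}{n}.$$ A finite subcollection $C$ of $\{1,\dots,n\}$ (repetitions allowed) with weights $u_i\ge 0$ is an $\varepsilon$-coreset if $$\frac{\bigl|\sum_{i=1}^n f_i(\beta)-\sum_{i\in C}u_i f_i(\beta)\bigr|}{\sum_{i=1}^n f_i(\beta)}\le\varepsilon\qquad\text{for all }\beta\in\mathbb R^d .$$ Let $S'=\frac{12n}{\lambda}+6$; in particular $S'=12n^{1-\kappa}+6$ if $\lambda=n^\kappa$ with $0<\kappa<1$. Let $\varepsilon,\delta\in(0,1)$, and let $q$ be an integer with $$q\ \ge\ \frac{10S'}{\varepsilon^2}\Bigl((d+1)\log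 S'+\log\frac1\delta\Bigr).$$ Then $q$ points drawn independently and uniformly (with replacement) from $\{1,\dots,n\}$, each with weight $n/q$, form an $\varepsilon$-coreset with probability at least $1-\delta$. -/

import Mathlib

open MeasureTheory ProbabilityTheory

noncomputable section

namespace RLM

/-- The logistic loss `log (1 + exp z)`. -/
def logisticLoss (z : ℝ) : ℝ := Real.log (1 + Real.exp z)

/-- The hinge (soft margin SVM) loss `max (0, 1 + z)`. -/
def hingeLoss (z : ℝ) : ℝ := max 0 (1 + z)

/-- The 1-norm regularizer. -/
def oneNorm {d : ℕ} (β : EuclideanSpace ℝ (Fin d)) : ℝ := ∑ j, |β j|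

/-- The 2-norm regularizer. -/
def twoNorm {d : ℕ} (β : EuclideanSpace ℝ (Fin d)) : ℝ := ‖β‖

/-- The squared 2-norm regularizer. -/
def twoNormSq {d : ℕ} (β : EuclideanSpace ℝ (Fin d)) : ℝ := ‖β‖ ^ 2

/-- `R`, the maximum 2-norm of a data point. -/
def maxNorm {n d : ℕ} (x : Fin n → EuclideanSpace ℝ (Fin d)) : ℝ := ⨆ i, ‖x i‖

/-- `f_i(β) = ℓ(-y_i β·x_i) + λ r(R β) / n`, the contribution of point `i` to the objective. -/
def pointCost {n d : ℕ} (ℓ : ℝ → ℝ) (r : EuclideanSpace ℝ (Fin d) → ℝ) (lam : ℝ)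
    (x : Fin n → EuclideanSpace ℝ (Fin d)) (y : Fin n → ℝ)
    (i : Fin n) (β : EuclideanSpace ℝ (Fin d)) : ℝ :=
  ℓ (-(y i) * inner ℝ β (x i)) + lam * r (maxNorm x • β) / n

/-- The subcollection `(C k)_k` of the data points (repetitions allowed), with weights `(u k)_k`,
is an `ε`-coreset of the regularized loss minimization instance `(x, y, ℓ, r, lam)`. -/
def IsCoreset {n d : ℕ} {ι : Type*} [Fintype ι] (ℓ : ℝ → ℝ)
    (r : EuclideanSpace ℝ (Fin d) → ℝ) (lam : ℝ)
    (x : Fin n → EuclideanSpace ℝ (Fin d)) (y : Fin n → ℝ) (ε : ℝ)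
    (C : ι → Fin n) (u : ι → ℝ) : Prop :=
  (∀ k, 0 ≤ u k) ∧
  ∀ β : EuclideanSpace ℝ (Fin d),
    |∑ i, pointCost ℓ r lam x y i β - ∑ k, u k * pointCost ℓ r lam x y (C k) β|
      / ∑ i, pointCost ℓ r lam x y i β ≤ ε

/-- The law of `q` independent draws from `Fin n`, each uniform. -/
def uniformSample (n q : ℕ) : Measure (Fin q → Fin n) :=
  Measure.pi fun _ => uniformOn Set.univ

end RLM

end

namespace RLM

/-! The weights sum to `n`, so the regularizer cancels from the coreset error. With `b = R • β`, `a
i = -y i • x i / R` and `μ = min (lam / n) 1`, it suffices to bound the sampling error of `ℓ (inner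
ℝ b (a i))`, uniformly in `b`, by `ε` times its mean plus `μ * ‖b‖ ^ 2 / max 1 ‖b‖`; this last
fraction is below all three regularizers (`norm_sq_div_max_le_regularizer`).

Both sides may be divided by `max 1 ‖b‖`. This turns `ℓ` into its perspective `persp` and moves the
parameter `(b, 1)` into the unit ball of a space of dimension `d + 1`. There the functions take
values in `[0, 2]`, are 2-Lipschitz in the parameter (`abs_persp_sub_le`), and the comparison
quantity `D` is at least `5 / 8 * μ`.

The uniform bound follows by chaining (`uniformSample_exists_lt_abs_sampleDev_le`). A relative
Bernstein inequality on the coarsest net costs `ε / 2 * D`. Hoeffding's inequality on the links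
between nets costs absolute errors that sum to at most `ε / 2` times the lower bound on `D`.
Coarsest radius of order `√μ` makes both exponents of order `q * μ * ε ^ 2`, so no logarithm of `1 /
ε` appears. Greedy nets, whose projections never increase `D`, let the relative error pass from a
net point to the points it represents. -/

/-! ### Tail bounds for uniform sampling -/

/-- The empirical mean of `φ` over the sample `C` minus its mean over all of `Fin n`. -/
noncomputable def sampleDev {n q : ℕ} (C : Fin q → Fin n) (φ : Fin n → ℝ) : ℝ :=
  (∑ k, φ (C k)) / q - (∑ i, φ i) / n

lemma sampleDev_sub {n q : ℕ} (C : Fin q → Fin n) (φ ψ : Fin n → ℝ) :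
    sampleDev C (fun i => φ i - ψ i) = sampleDev C φ - sampleDev C ψ := by
  simp only [sampleDev, Finset.sum_sub_distrib]
  ring

instance isProbabilityMeasure_uniformSample {n q : ℕ} [NeZero n] :
    IsProbabilityMeasure (uniformSample n q) := by
  unfold uniformSample
  infer_instance

lemma integral_uniformOn_univ_fin {n : ℕ} [NeZero n] (f : Fin n → ℝ) :
    ∫ i, f i ∂(uniformOn (Set.univ : Set (Fin n))) = (∑ i, f i) / n := by
  rw [integral_fintype (Integrable.of_finite), Finset.sum_div]
  refine Finset.sum_congr rfl fun i _ => ?_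
  rw [measureReal_def, uniformOn_univ, Measure.count_singleton]
  simp
  ring

/-- Chernoff's bound for independent uniform draws. -/
lemma uniformSample_sum_ge_le {n q : ℕ} [NeZero n] (φ : Fin n → ℝ) {θ κ : ℝ} (hθ : 0 ≤ θ)
    (h : (∑ i, Real.exp (θ * φ i)) / n ≤ Real.exp κ) (a : ℝ) :
    (uniformSample n q).real {C | a ≤ ∑ k, φ (C k)} ≤ Real.exp (q * κ - θ * a) := by
  have h1 := measure_ge_le_exp_mul_mgf (μ := uniformSample n q)
    (X := fun C : Fin q → Fin n => ∑ k, φ (C k)) a hθ Integrable.of_finite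
  refine h1.trans ?_
  have h2 : mgf (fun C : Fin q → Fin n => ∑ k, φ (C k)) (uniformSample n q) θ
      = ((∑ i, Real.exp (θ * φ i)) / n) ^ q := by
    unfold mgf
    simp_rw [Finset.mul_sum, Real.exp_sum]
    unfold uniformSample
    rw [integral_fintype_prod_eq_prod (fun _ : Fin q => fun i => Real.exp (θ * φ i))]
    simp [integral_uniformOn_univ_fin, div_pow]
  rw [h2, sub_eq_add_neg, Real.exp_add, Real.exp_nat_mul, mul_comm, neg_mul]
  gcongr

/-- Chernoff's bound applied to `φ` and `-φ`, shared by the Hoeffding and Bernstein inequalities,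
which differ only in `θ` and `κ`. -/
lemma uniformSample_lt_abs_sampleDev_le {n q : ℕ} [NeZero n] (hq : 0 < q) (φ : Fin n → ℝ)
    {θ κ s : ℝ} (hθ : 0 ≤ θ)
    (h₁ : (∑ i, Real.exp (θ * φ i)) / n ≤ Real.exp (θ * ((∑ i, φ i) / n) + κ))
    (h₂ : (∑ i, Real.exp (θ * -φ i)) / n ≤ Real.exp (-(θ * ((∑ i, φ i) / n)) + κ)) :
    (uniformSample n q).real {C | s < |sampleDev C φ|} ≤ 2 * Real.exp (-(q * (θ * s - κ))) := by
  set m := (∑ i, φ i) / n with hm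
  have hq' : (0 : ℝ) < q := by exact_mod_cast hq
  have e₁ := uniformSample_sum_ge_le (q := q) φ hθ h₁ (q * (m + s))
  have e₂ := uniformSample_sum_ge_le (q := q) (fun i => -φ i) hθ h₂ (q * (s - m))
  have hsub : {C : Fin q → Fin n | s < |sampleDev C φ|} ⊆
      {C | q * (m + s) ≤ ∑ k, φ (C k)} ∪ {C | q * (s - m) ≤ ∑ k, -φ (C k)} := by
    intro C hC
    simp only [Set.mem_ofPred_eq, sampleDev, ← hm, Set.mem_union] at hC ⊢
    have hx : ∑ k, φ (C k) = q * ((∑ k, φ (C k)) / q) := by field_simp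
    rcases lt_abs.1 hC with h | h
    · left
      rw [hx]
      exact mul_le_mul_of_nonneg_left (by linarith) hq'.le
    · right
      rw [Finset.sum_neg_distrib, hx, ← mul_neg]
      exact mul_le_mul_of_nonneg_left (by linarith) hq'.le
  calc _ ≤ _ := measureReal_mono hsub
    _ ≤ _ := measureReal_union_le _ _
    _ ≤ _ := add_le_add e₁ e₂
    _ = _ := by
      rw [two_mul]
      congr 2 <;> ring

/-- Hoeffding's inequality for independent uniform draws. -/
lemma uniformSample_hoeffding {n q : ℕ} [NeZero n] (hq : 0 < q) (φ : Fin n → ℝ)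
    {B s : ℝ} (hB : 0 < B) (hs : 0 ≤ s) (hφ : ∀ i, |φ i| ≤ B) :
    (uniformSample n q).real {C | s < |sampleDev C φ|} ≤
      2 * Real.exp (-(q * (s ^ 2 / (2 * B ^ 2)))) := by
  have key : ∀ ψ : Fin n → ℝ, (∀ i, |ψ i| ≤ B) → ∀ θ : ℝ,
      (∑ i, Real.exp (θ * ψ i)) / n ≤
        Real.exp (θ * ((∑ i, ψ i) / n) + B ^ 2 * θ ^ 2 / 2) := by
    intro ψ hψ θ
    have h := (hasSubgaussianMGF_of_mem_Icc (μ := uniformOn (Set.univ : Set (Fin n))) (X := ψ)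
      (a := -B) (b := B) (measurable_of_finite ψ).aemeasurable
      (Filter.Eventually.of_forall fun i => abs_le.1 (hψ i))).mgf_le θ
    unfold mgf at h
    rw [integral_uniformOn_univ_fin, integral_uniformOn_univ_fin] at h
    have hc : (((‖B - -B‖₊ / 2) ^ 2 : NNReal) : ℝ) = B ^ 2 := by
      push_cast
      rw [Real.norm_eq_abs, abs_of_pos (by linarith)]
      ring
    rw [hc] at h
    rw [Real.exp_add]
    have h' : (∑ i, Real.exp (θ * ψ i)) / n
        = Real.exp (θ * ((∑ i, ψ i) / n)) *
          ((∑ i, Real.exp (θ * (ψ i - (∑ i, ψ i) / n))) / n) := by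
      rw [mul_div_assoc', Finset.mul_sum]
      congr 1
      refine Finset.sum_congr rfl fun i _ => ?_
      rw [← Real.exp_add]
      congr 1
      ring
    rw [h']
    gcongr
  have hθ : 0 ≤ s / B ^ 2 := by positivity
  have h₂ := key (fun i => -φ i) (fun i => by simpa using hφ i) (s / B ^ 2)
  rw [Finset.sum_neg_distrib, neg_div, mul_neg] at h₂
  refine (uniformSample_lt_abs_sampleDev_le hq φ hθ (key φ hφ _) h₂).trans (le_of_eq ?_)
  congr 3
  field_simp
  ring

/-- On this range the cubic term and the Taylor remainder fit into the excess of `7 / 12` over `1 /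
2`. -/
lemma exp_le_of_abs_le {y : ℝ} (hy : |y| ≤ 3 / 7) : Real.exp y ≤ 1 + y + 7 / 12 * y ^ 2 := by
  have h := Real.exp_bound (x := y) (n := 4) (by linarith) (by norm_num)
  simp only [Finset.sum_range_succ, Finset.sum_range_zero, Nat.factorial] at h
  norm_num at h
  have h2 := (abs_le.1 h).2
  rw [abs_le] at hy
  have h4 : |y| ^ 4 = y ^ 4 := by
    rw [show (4 : ℕ) = 2 * 2 from rfl, pow_mul, pow_mul, sq_abs]
  rw [h4] at h2
  nlinarith [sq_nonneg y, mul_nonneg (sq_nonneg y) (sub_nonneg.2 hy.2),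
    mul_nonneg (sq_nonneg y) (by linarith [hy.1] : 0 ≤ y + 3 / 7),
    mul_nonneg (mul_nonneg (sq_nonneg y) (sub_nonneg.2 hy.2)) (by linarith [hy.1] : 0 ≤ y + 3 / 7)]

/-- A relative Bernstein inequality for independent uniform draws of a bounded nonnegative
function. -/
lemma uniformSample_bernstein {n q : ℕ} [NeZero n] (hq : 0 < q) (φ : Fin n → ℝ)
    {M D u : ℝ} (hM : 0 < M) (hu : 0 ≤ u) (hu' : u ≤ 1 / 2)
    (h0 : ∀ i, 0 ≤ φ i) (hφ : ∀ i, φ i ≤ M) (hmean : (∑ i, φ i) / n ≤ D) :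
    (uniformSample n q).real {C | u * D < |sampleDev C φ|} ≤
      2 * Real.exp (-(q * (3 / 7 * (D / M) * u ^ 2))) := by
  have hn : (0 : ℝ) < n := by exact_mod_cast Nat.pos_of_ne_zero (NeZero.ne n)
  have key : ∀ y : ℝ, |y| ≤ 3 / 7 →
      (∑ i, Real.exp (y / M * φ i)) / n ≤
        Real.exp (y / M * ((∑ i, φ i) / n) + 7 / 12 * y ^ 2 * (D / M)) := by
    intro y hy
    have hpt : ∀ i, Real.exp (y / M * φ i) ≤ 1 + φ i * ((y + 7 / 12 * y ^ 2) / M) := by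
      intro i
      -- The chord of `exp` over the segment from `0` to `y` makes the bound linear in `φ i`, so the
      -- mean, not the second moment, controls the exponent.
      have hc := convexOn_exp.2 (Set.mem_univ 0) (Set.mem_univ y)
        (sub_nonneg.2 ((div_le_one hM).2 (hφ i))) (div_nonneg (h0 i) hM.le) (sub_add_cancel _ _)
      simp only [smul_eq_mul, mul_zero, zero_add, Real.exp_zero, mul_one] at hc
      have hE := exp_le_of_abs_le hy
      calc Real.exp (y / M * φ i) = Real.exp (φ i / M * y) := by congr 1; ring
        _ ≤ _ := hc
        _ ≤ 1 - φ i / M + φ i / M * (1 + y + 7 / 12 * y ^ 2) := by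
          gcongr
          exact div_nonneg (h0 i) hM.le
        _ = _ := by ring
    calc (∑ i, Real.exp (y / M * φ i)) / n
        ≤ (∑ i, (1 + φ i * ((y + 7 / 12 * y ^ 2) / M))) / n := by
          gcongr with i
          exact hpt i
      _ = (y / M * ((∑ i, φ i) / n) + 7 / 12 * y ^ 2 * (((∑ i, φ i) / n) / M)) + 1 := by
          rw [Finset.sum_add_distrib, ← Finset.sum_mul]
          simp
          field_simp
          ring
      _ ≤ (y / M * ((∑ i, φ i) / n) + 7 / 12 * y ^ 2 * (D / M)) + 1 := by gcongr
      _ ≤ _ := Real.add_one_le_exp _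
  -- `6 / 7 * u` maximizes `y * u - 7 / 12 * y ^ 2`, with value `3 / 7 * u ^ 2`.
  have hy : |6 / 7 * u| ≤ 3 / 7 := by
    rw [abs_of_nonneg (by positivity)]
    linarith
  have h₁ := key (6 / 7 * u) hy
  have h₂ := key (-(6 / 7 * u)) (by rwa [abs_neg])
  have h₂' : (∑ i, Real.exp (6 / 7 * u / M * -φ i)) / n ≤
      Real.exp (-(6 / 7 * u / M * ((∑ i, φ i) / n)) + 7 / 12 * (6 / 7 * u) ^ 2 * (D / M)) := by
    convert! h₂ using 3
    · congr 1
      ring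
    · ring
    · ring
  refine (uniformSample_lt_abs_sampleDev_le hq φ (by positivity) h₁ h₂').trans (le_of_eq ?_)
  congr 3
  field_simp
  ring

/-! ### Admissible losses and their perspectives -/

/-- The properties of the logistic and of the hinge loss that the sampling bound uses. -/
structure IsAdmissibleLoss (ℓ : ℝ → ℝ) : Prop where
  nonneg : ∀ z, 0 ≤ ℓ z
  mono : Monotone ℓ
  le_self : ∀ z, z ≤ ℓ z
  sub_le : ∀ ⦃z w⦄, z ≤ w → ℓ w - ℓ z ≤ w - z
  convex : ConvexOn ℝ Set.univ ℓ
  zero_le_one : ℓ 0 ≤ 1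
  neg_add_sq : ∀ t, 0 ≤ t → t ≤ 1 → 5 / 8 ≤ ℓ (-t) + t ^ 2

lemma hasDerivAt_logisticLoss (z : ℝ) : HasDerivAt logisticLoss (Real.sigmoid z) z := by
  have h := ((Real.hasDerivAt_exp z).const_add 1).log (by positivity)
  convert! h using 1
  rw [Real.sigmoid_def, Real.exp_neg]
  have := Real.exp_pos z
  field_simp
  ring

lemma convexOn_logisticLoss : ConvexOn ℝ Set.univ logisticLoss := by
  have hd : deriv logisticLoss = Real.sigmoid := funext fun z => (hasDerivAt_logisticLoss z).deriv
  refine Monotone.convexOn_univ_of_deriv (fun z => (hasDerivAt_logisticLoss z).differentiableAt) ?_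
  rw [hd]
  exact Real.sigmoid_monotone

lemma isAdmissibleLoss_logisticLoss : IsAdmissibleLoss logisticLoss where
  nonneg z := Real.log_nonneg (by linarith [Real.exp_pos z])
  mono z w h := by
    unfold logisticLoss
    gcongr
  le_self z := by
    rw [logisticLoss, Real.le_log_iff_exp_le (by positivity)]
    linarith
  sub_le z w h := by
    have : logisticLoss w ≤ Real.log (Real.exp (w - z) * (1 + Real.exp z)) := by
      unfold logisticLoss
      gcongr
      rw [mul_add, ← Real.exp_add, sub_add_cancel, mul_one]
      gcongr
      exact Real.one_le_exp (by linarith)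
    rw [Real.log_mul (by positivity) (by positivity), Real.log_exp] at this
    rw [logisticLoss] at *
    linarith [show logisticLoss z = Real.log (1 + Real.exp z) from rfl]
  convex := convexOn_logisticLoss
  zero_le_one := by
    rw [logisticLoss, Real.exp_zero]
    have := Real.log_two_lt_d9
    norm_num
    linarith
  neg_add_sq t _ _ := by
    -- Exponentiated, this is AM-GM for `1` and `exp (-t)`. Then `log 2 - t / 2 + t ^ 2` is smallest
    -- at `t = 1 / 4`, just above `5 / 8`.
    have h : Real.log 2 - t / 2 ≤ logisticLoss (-t) := by
      rw [logisticLoss, Real.le_log_iff_exp_le (by positivity), Real.exp_sub,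
        Real.exp_log (by norm_num), div_le_iff₀ (Real.exp_pos _)]
      have e : Real.exp t = Real.exp (t / 2) ^ 2 := by rw [← Real.exp_nat_mul]; congr 1; ring
      rw [Real.exp_neg, e]
      have := Real.exp_pos (t / 2)
      field_simp
      nlinarith [sq_nonneg (Real.exp (t / 2) - 1)]
    nlinarith [Real.log_two_gt_d9, sq_nonneg (t - 1 / 4)]

lemma isAdmissibleLoss_hingeLoss : IsAdmissibleLoss hingeLoss where
  nonneg z := le_max_left _ _
  mono z w h := by
    unfold hingeLoss
    gcongr
  le_self z := le_max_of_le_right (by linarith)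
  sub_le z w h := by
    unfold hingeLoss
    grind
  convex := (convexOn_const 0 convex_univ).sup ((convexOn_const 1 convex_univ).add
    (convexOn_id convex_univ))
  zero_le_one := by simp [hingeLoss]
  neg_add_sq t _ _ := by
    have : 1 + -t ≤ hingeLoss (-t) := le_max_right _ _
    nlinarith [sq_nonneg (t - 1 / 2)]

/-- The perspective `s * ℓ (z / s)` of a loss function. -/
noncomputable def persp (ℓ : ℝ → ℝ) (z s : ℝ) : ℝ := s * ℓ (z / s)

namespace IsAdmissibleLoss

variable {ℓ : ℝ → ℝ}

lemma abs_sub_le (h : IsAdmissibleLoss ℓ) (z w : ℝ) : |ℓ z - ℓ w| ≤ |z - w| := by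
  rcases le_total z w with hzw | hzw
  · rw [abs_sub_comm, abs_of_nonneg (sub_nonneg.2 (h.mono hzw)), abs_sub_comm,
      abs_of_nonneg (sub_nonneg.2 hzw)]
    exact h.sub_le hzw
  · rw [abs_of_nonneg (sub_nonneg.2 (h.mono hzw)), abs_of_nonneg (sub_nonneg.2 hzw)]
    exact h.sub_le hzw

lemma persp_nonneg (h : IsAdmissibleLoss ℓ) (z : ℝ) {s : ℝ} (hs : 0 < s) : 0 ≤ persp ℓ z s :=
  mul_nonneg hs.le (h.nonneg _)

lemma abs_persp_sub_left_le (h : IsAdmissibleLoss ℓ) (z w : ℝ) {s : ℝ} (hs : 0 < s) :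
    |persp ℓ z s - persp ℓ w s| ≤ |z - w| := by
  have := h.abs_sub_le (z / s) (w / s)
  rw [← sub_div, abs_div, abs_of_pos hs, le_div_iff₀ hs] at this
  rw [persp, persp, ← mul_sub, abs_mul, abs_of_pos hs, mul_comm]
  exact this

/-- For `z ≤ 0` both factors grow with `s`. For `z ≥ 0`, subtract the constant `z = s * (z / s)`:
what remains is `s` times `ℓ u - u`, which is nonnegative and nonincreasing in `u = z / s`. -/
lemma persp_mono_right (h : IsAdmissibleLoss ℓ) (z : ℝ) {s t : ℝ} (hs : 0 < s) (hst : s ≤ t) :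
    persp ℓ z s ≤ persp ℓ z t := by
  have ht : 0 < t := hs.trans_le hst
  unfold persp
  rcases le_total 0 z with hz | hz
  · have hle : z / t ≤ z / s := div_le_div_of_nonneg_left hz hs hst
    have h1 := mul_le_mul_of_nonneg_left (h.sub_le hle) hs.le
    have h2 := mul_le_mul_of_nonneg_right hst (sub_nonneg.2 (h.le_self (z / t)))
    have e1 : s * (z / s) = z := by field_simp
    have e2 : t * (z / t) = z := by field_simp
    linarith
  · have hle : z / s ≤ z / t := by
      rw [div_le_div_iff₀ hs ht]
      nlinarith
    exact mul_le_mul hst (h.mono hle) (h.nonneg _) ht.le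

/-- Convexity at `z / t`, a convex combination of `z / s` and `0`, bounds the growth by `(t - s) * ℓ
0`. -/
lemma persp_sub_right_le (h : IsAdmissibleLoss ℓ) (z : ℝ) {s t : ℝ} (hs : 0 < s) (hst : s ≤ t) :
    persp ℓ z t - persp ℓ z s ≤ t - s := by
  have ht : 0 < t := hs.trans_le hst
  have hc := h.convex.2 (Set.mem_univ (z / s)) (Set.mem_univ 0) (div_nonneg hs.le ht.le)
    (div_nonneg (sub_nonneg.2 hst) ht.le) (by field_simp; ring)
  simp only [smul_eq_mul, mul_zero, add_zero] at hc
  have e : s / t * (z / s) = z / t := by field_simp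
  rw [e] at hc
  have h2 := mul_le_mul_of_nonneg_left hc ht.le
  have e2 : t * (s / t * ℓ (z / s) + (t - s) / t * ℓ 0) = s * ℓ (z / s) + (t - s) * ℓ 0 := by
    field_simp
  rw [e2] at h2
  have h3 := mul_le_mul_of_nonneg_left h.zero_le_one (sub_nonneg.2 hst)
  unfold persp
  linarith

lemma abs_persp_sub_le (h : IsAdmissibleLoss ℓ) (z w : ℝ) {s t : ℝ} (hs : 0 < s) (ht : 0 < t) :
    |persp ℓ z s - persp ℓ w t| ≤ |z - w| + |s - t| := by
  have h1 := h.abs_persp_sub_left_le z w hs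
  have h2 : |persp ℓ w s - persp ℓ w t| ≤ |s - t| := by
    rcases le_total s t with hst | hst
    · rw [abs_sub_comm, abs_of_nonneg (sub_nonneg.2 (h.persp_mono_right w hs hst)), abs_sub_comm,
        abs_of_nonneg (sub_nonneg.2 hst)]
      exact h.persp_sub_right_le w hs hst
    · rw [abs_of_nonneg (sub_nonneg.2 (h.persp_mono_right w ht hst)),
        abs_of_nonneg (sub_nonneg.2 hst)]
      exact h.persp_sub_right_le w ht hst
  exact (_root_.abs_sub_le _ (persp ℓ w s) _).trans (add_le_add h1 h2)

lemma persp_le_two (h : IsAdmissibleLoss ℓ) {z s : ℝ} (hs : 0 < s) (hs1 : s ≤ 1) (hz : |z| ≤ 1) :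
    persp ℓ z s ≤ 2 := by
  have h1 := (abs_le.1 (h.abs_persp_sub_left_le z 0 hs)).2
  have h2 : persp ℓ 0 s ≤ 1 := by
    rw [persp, zero_div]
    exact mul_le_one₀ hs1 (h.nonneg _) h.zero_le_one
  rw [sub_zero] at h1
  linarith

end IsAdmissibleLoss

/-! ### Greedy nets and their cardinality -/

/-- A greedy net: a separated subset such that every point is close to a net point
at which `D` is no larger. -/
lemma exists_separated_net {X : Type*} [PseudoMetricSpace X] [DecidableEq X] (D : X → ℝ) {η : ℝ}
    (hη : 0 ≤ η) (F : Finset X) :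
    ∃ A ⊆ F, (∀ a ∈ A, ∀ b ∈ A, a ≠ b → η ≤ dist a b) ∧
      ∀ p ∈ F, ∃ a ∈ A, dist p a ≤ η ∧ D a ≤ D p := by
  induction F using Finset.strongInduction with
  | H F ih =>
    rcases F.eq_empty_or_nonempty with rfl | hF
    · exact ⟨∅, by simp⟩
    obtain ⟨c, hc, hmin⟩ := F.exists_min_image D hF
    set G := F.filter fun p => η < dist p c with hG
    have hGF : G ⊆ F := Finset.filter_subset _ _
    have hcG : c ∉ G := by simp [hG, hη]
    obtain ⟨A, hA, hsep, hcov⟩ := ih G (Finset.ssubset_iff_subset_ne.2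
      ⟨hGF, fun h => hcG (h ▸ hc)⟩)
    refine ⟨insert c A, Finset.insert_subset hc (hA.trans hGF), ?_, ?_⟩
    · have hfar : ∀ a ∈ A, η ≤ dist a c := fun a ha => (Finset.mem_filter.1 (hA ha)).2.le
      intro a ha b hb hab
      rcases Finset.mem_insert.1 ha with rfl | ha'
      · rcases Finset.mem_insert.1 hb with rfl | hb
        · exact absurd rfl hab
        · rw [dist_comm]
          exact hfar b hb
      · rcases Finset.mem_insert.1 hb with rfl | hb
        · exact hfar a ha'
        · exact hsep a ha' b hb hab
    · intro p hp
      by_cases h : η < dist p c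
      · obtain ⟨a, ha, h'⟩ := hcov p (Finset.mem_filter.2 ⟨hp, h⟩)
        exact ⟨a, Finset.mem_insert_of_mem ha, h'⟩
      · exact ⟨c, Finset.mem_insert_self _ _, not_lt.1 h, hmin p hp⟩

open Metric Module in
/-- The volume bound on the size of a separated subset of the unit ball. -/
lemma card_le_of_separated_of_norm_le_one {E : Type*} [NormedAddCommGroup E] [NormedSpace ℝ E]
    [FiniteDimensional ℝ E] (s : Finset E) {η : ℝ} (hη : 0 < η) (hs : ∀ c ∈ s, ‖c‖ ≤ 1)
    (h : ∀ a ∈ s, ∀ b ∈ s, a ≠ b → η ≤ dist a b) :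
    (s.card : ℝ) ≤ (1 + 2 / η) ^ finrank ℝ E := by
  borelize E
  let μ : Measure E := Measure.addHaar
  have hδ : 0 < η / 2 := by positivity
  have hρ : 0 < 1 + η / 2 := by positivity
  have hdisj : Set.Pairwise (s : Set E) (Function.onFun Disjoint fun c => ball (c : E) (η / 2)) := by
    intro c hc d hd hcd
    apply ball_disjoint_ball
    linarith [h c hc d hd hcd]
  have hsub : (⋃ c ∈ s, ball (c : E) (η / 2)) ⊆ ball (0 : E) (1 + η / 2) := by
    refine Set.iUnion₂_subset fun x hx => ball_subset_ball' ?_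
    rw [dist_zero_right]
    linarith [hs x hx]
  have hI : (s.card : ENNReal) * ENNReal.ofReal ((η / 2) ^ finrank ℝ E) * μ (ball 0 1) ≤
      ENNReal.ofReal ((1 + η / 2) ^ finrank ℝ E) * μ (ball 0 1) := by
    calc _ = μ (⋃ c ∈ s, ball (c : E) (η / 2)) := by
          rw [measure_biUnion_finset hdisj fun c _ => measurableSet_ball]
          simp only [μ.addHaar_ball_of_pos _ hδ, Finset.sum_const, nsmul_eq_mul, mul_assoc]
      _ ≤ μ (ball (0 : E) (1 + η / 2)) := measure_mono hsub
      _ = _ := by rw [μ.addHaar_ball_of_pos _ hρ]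
  have hJ := (ENNReal.mul_le_mul_iff_left (measure_ball_pos μ _ zero_lt_one).ne'
    measure_ball_lt_top.ne).1 hI
  have hK := ENNReal.toReal_le_of_le_ofReal (pow_nonneg hρ.le _) hJ
  rw [ENNReal.toReal_mul, ENNReal.toReal_natCast, ENNReal.toReal_ofReal (by positivity),
    ← le_div_iff₀ (by positivity), ← div_pow] at hK
  refine hK.trans (le_of_eq ?_)
  congr 1
  field_simp
  ring

/-- The right side is `√(6 / μ) ^ (3 + j)`. As `√6 > 2`, `j` factors absorb `2 ^ j`; the other three
absorb `43 / 3 / √μ`, because `6 * √6 > 43 / 3`. -/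
lemma one_add_two_div_le {μ : ℝ} (hμ : 0 < μ) (hμ1 : μ ≤ 1) (j : ℕ) :
    1 + 2 / (3 / 20 * √μ * (1 / 2) ^ j) ≤ Real.exp ((3 / 2 + j / 2) * Real.log (6 / μ)) := by
  have hsμ : 0 < √μ := Real.sqrt_pos.2 hμ
  have hsμ1 : √μ ≤ 1 := Real.sqrt_le_one.2 hμ1
  have hlog : Real.log (√6 / √μ) = Real.log (6 / μ) / 2 := by
    rw [← Real.sqrt_div (by norm_num), Real.log_sqrt (by positivity)]
  have h6 : (2.449 : ℝ) ≤ √6 := Real.le_sqrt_of_sq_le (by norm_num)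
  have hQ : √6 ≤ √6 / √μ := by
    rw [le_div_iff₀ hsμ]
    nlinarith
  have e : Real.exp ((3 / 2 + j / 2) * Real.log (6 / μ)) = (√6 / √μ) ^ 3 * (√6 / √μ) ^ j := by
    rw [← pow_add, ← Real.exp_log (show 0 < √6 / √μ by positivity), ← Real.exp_nat_mul, hlog]
    congr 1
    push_cast
    ring
  rw [e]
  have h2 : (2 : ℝ) ^ j ≤ (√6 / √μ) ^ j := by
    gcongr
    linarith
  have h1 : (1 : ℝ) ≤ 2 ^ j := one_le_pow₀ (by norm_num)
  have h3 : 43 / 3 / √μ ≤ (√6 / √μ) ^ 3 := by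
    have : (√6 / √μ) ^ 3 = 6 * √6 / √μ * (1 / μ) := by
      rw [div_pow, pow_succ, pow_succ √μ, Real.sq_sqrt (by norm_num), Real.sq_sqrt hμ.le]
      field_simp
    rw [this]
    calc 43 / 3 / √μ ≤ 6 * √6 / √μ := by gcongr; linarith
      _ = 6 * √6 / √μ * 1 := (mul_one _).symm
      _ ≤ _ := by
        gcongr
        rw [le_div_iff₀ hμ]
        linarith
  calc 1 + 2 / (3 / 20 * √μ * (1 / 2) ^ j) = 1 + 40 / 3 / √μ * 2 ^ j := by
        rw [one_div, inv_pow]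
        field_simp
        ring
    _ ≤ 1 / √μ * 2 ^ j + 40 / 3 / √μ * 2 ^ j := by
        gcongr
        have : 1 ≤ 1 / √μ := by
          rw [le_div_iff₀ hsμ]
          linarith
        nlinarith
    _ = 43 / 3 / √μ * 2 ^ j := by ring
    _ ≤ _ := by gcongr

lemma exp_neg_half_log_le {μ : ℝ} (hμ : 0 < μ) (hμ1 : μ ≤ 1) :
    Real.exp (-(Real.log (6 / μ) / 2)) ≤ 0.41 := by
  have h1 : Real.exp (-(Real.log (6 / μ) / 2)) ^ 2 = μ / 6 := by
    rw [← Real.exp_nat_mul, show ((2 : ℕ) : ℝ) * -(Real.log (6 / μ) / 2) = -Real.log (6 / μ) by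
      push_cast; ring, Real.exp_neg, Real.exp_log (by positivity), inv_div]
  refine (sq_le_sq₀ (Real.exp_pos _).le (by norm_num)).1 ?_
  rw [h1]
  norm_num
  linarith

/-! ### Chaining -/

/-- The uniform relative deviation bound on a finite subset of the unit ball, by chaining along
greedy nets. -/
theorem uniformSample_exists_lt_abs_sampleDev_le {n q : ℕ} [NeZero n]
    {E : Type*} [NormedAddCommGroup E] [NormedSpace ℝ E] [FiniteDimensional ℝ E]
    (hv : 0 < Module.finrank ℝ E) (F : Finset E) (φ : E → Fin n → ℝ) (D : E → ℝ)
    {μ ε δ : ℝ} (hμ : 0 < μ) (hμ1 : μ ≤ 1) (hε : 0 < ε) (hε1 : ε < 1) (hδ : 0 < δ) (hδ1 : δ < 1)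
    (hF : ∀ p ∈ F, ‖p‖ ≤ 1) (hφ0 : ∀ p ∈ F, ∀ i, 0 ≤ φ p i) (hφ2 : ∀ p ∈ F, ∀ i, φ p i ≤ 2)
    (hlip : ∀ p ∈ F, ∀ p' ∈ F, ∀ i, |φ p i - φ p' i| ≤ 2 * dist p p')
    (hmean : ∀ p ∈ F, (∑ i, φ p i) / n ≤ D p) (hD : ∀ p ∈ F, 5 / 8 * μ ≤ D p)
    (hq : 60 / (μ * ε ^ 2) * (Module.finrank ℝ E * Real.log (6 / μ) + Real.log (1 / δ)) ≤ q) :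
    (uniformSample n q).real {C | ∃ p ∈ F, ε * D p < |sampleDev C (φ p)|} ≤ δ := by
  classical
  set v := Module.finrank ℝ E with hv_def
  set l := Real.log (6 / μ) with hl_def
  set L := v * l + Real.log (1 / δ) with hL_def
  have hv1 : (1 : ℝ) ≤ v := by exact_mod_cast hv
  have hl : 0 < l := Real.log_pos (by rw [lt_div_iff₀ hμ]; linarith)
  have hlogδ : 0 < Real.log (1 / δ) := Real.log_pos (by rw [lt_div_iff₀ hδ]; linarith)
  have hL : 0 < L := by positivity
  have hq0 : 0 < q := by
    have : (0 : ℝ) < q := lt_of_lt_of_le (by positivity) hq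
    exact_mod_cast this
  have hsμ : 0 < √μ := Real.sqrt_pos.2 hμ
  have hsμ2 : √μ ^ 2 = μ := Real.sq_sqrt hμ.le
  let η : ℕ → ℝ := fun j => 3 / 20 * √μ * (1 / 2) ^ j
  have hη : ∀ j, 0 < η j := fun j => by positivity
  choose A hAF hsep hcov using fun j => exists_separated_net D (hη j).le F
  have hcov' : ∀ j p, ∃ a, p ∈ F → a ∈ A j ∧ dist p a ≤ η j ∧ D a ≤ D p := by
    intro j p
    by_cases hp : p ∈ F
    · obtain ⟨a, ha⟩ := hcov j p hp
      exact ⟨a, fun _ => ha⟩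
    · exact ⟨p, fun h => absurd h hp⟩
  choose π hπ using hcov'
  have hcard : ∀ j, ((A j).card : ℝ) ≤ Real.exp (v * ((3 / 2 + j / 2) * l)) := by
    intro j
    refine (card_le_of_separated_of_norm_le_one (A j) (hη j) (fun c hc => hF c (hAF j hc))
      (hsep j)).trans ?_
    rw [Real.exp_nat_mul]
    gcongr
    exact one_add_two_div_le hμ hμ1 j
  -- `F` is finite, so once `η J` is below all its nonzero distances each point is its own net point
  -- and the chain ends.
  obtain ⟨J, hJ⟩ : ∃ J, F ⊆ A J := by
    have hlim : Filter.Tendsto η Filter.atTop (nhds 0) := by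
      have := (tendsto_pow_atTop_nhds_zero_of_lt_one (r := (1 / 2 : ℝ)) (by norm_num)
        (by norm_num)).const_mul (3 / 20 * √μ)
      simpa only [mul_zero] using this
    have hev : ∀ᶠ j in Filter.atTop, ∀ p ∈ F, ∀ a ∈ F, p ≠ a → η j < dist p a := by
      rw [Filter.eventually_all_finset]
      intro p _
      rw [Filter.eventually_all_finset]
      intro a _
      by_cases hpa : p = a
      · exact Filter.Eventually.of_forall fun j h => absurd hpa h
      · filter_upwards [hlim.eventually_lt_const (dist_pos.2 hpa)] with j hj _ using hj
    obtain ⟨J, hJ⟩ := hev.exists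
    refine ⟨J, fun p hp => ?_⟩
    obtain ⟨ha, hd, -⟩ := hπ J p hp
    by_cases hpa : p = π J p
    · rw [hpa]
      exact ha
    · exact absurd hd (not_le.2 (hJ p hp _ (hAF J ha) hpa))
  -- The sum is half of `ε * (5 / 8 * μ)`. Decay slower than that of `η` makes the Hoeffding
  -- exponents grow like `(16 / 9) ^ j`, faster than the log-cardinalities, which are linear in `j`.
  let s : ℕ → ℝ := fun j => ε * (5 / 8 * μ) * (1 / 6 * (2 / 3) ^ j)
  have hs : ∀ j, 0 < s j := fun j => by positivity
  let B₀ : Set (Fin q → Fin n) := ⋃ p ∈ A 0, {C | ε / 2 * D p < |sampleDev C (φ p)|}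
  let B : ℕ → Set (Fin q → Fin n) := fun j =>
    ⋃ p ∈ A (j + 1), {C | s j < |sampleDev C (fun i => φ p i - φ (π j p) i)|}
  have hsub : {C : Fin q → Fin n | ∃ p ∈ F, ε * D p < |sampleDev C (φ p)|} ⊆
      B₀ ∪ ⋃ j ∈ Finset.range J, B j := by
    intro C hC
    by_contra hgood
    simp only [B₀, B, Set.mem_union, Set.mem_iUnion, Set.mem_ofPred_eq, exists_prop, not_or,
      not_exists, not_and, not_lt, Finset.mem_range] at hgood
    obtain ⟨hg0, hg⟩ := hgood
    have hind : ∀ j ≤ J, ∀ p ∈ A j,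
        |sampleDev C (φ p)| ≤ ε / 2 * D p + ∑ i ∈ Finset.range j, s i := by
      intro j
      induction j with
      | zero => intro _ p hp; simpa using hg0 p hp
      | succ j ih =>
        intro hj p hp
        obtain ⟨ha, -, hDa⟩ := hπ j p (hAF _ hp)
        have h1 := ih (by omega) _ ha
        have h2 := hg j (by omega) p hp
        rw [sampleDev_sub] at h2
        have h3 : |sampleDev C (φ p)| ≤ |sampleDev C (φ p) - sampleDev C (φ (π j p))| +
            |sampleDev C (φ (π j p))| := by
          simpa using abs_add_le (sampleDev C (φ p) - sampleDev C (φ (π j p)))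
            (sampleDev C (φ (π j p)))
        have h4 : ε / 2 * D (π j p) ≤ ε / 2 * D p := by gcongr
        rw [Finset.sum_range_succ]
        linarith
    obtain ⟨p, hp, hbad⟩ := hC
    have h1 := hind J le_rfl p (hJ hp)
    have h2 : ∑ i ∈ Finset.range J, s i ≤ ε * (5 / 8 * μ) * (1 / 2) := by
      have hg : ∑ i ∈ Finset.range J, (2 / 3 : ℝ) ^ i ≤ 3 := by
        have := (summable_geometric_of_lt_one (r := (2 / 3 : ℝ)) (by norm_num)
          (by norm_num)).sum_le_tsum (Finset.range J) fun _ _ => by positivity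
        rw [tsum_geometric_of_lt_one (by norm_num) (by norm_num)] at this
        norm_num at this ⊢
        exact this
      simp only [s]
      rw [← Finset.mul_sum, ← Finset.mul_sum]
      gcongr
      linarith
    have h3 : ε * (5 / 8 * μ) * (1 / 2) ≤ ε / 2 * D p := by
      have := mul_le_mul_of_nonneg_left (hD p hp) hε.le
      linarith
    linarith
  set h := Real.exp (-(l / 2)) with hh_def
  have hh0 : 0 < h := Real.exp_pos _
  have hh : h ≤ 0.41 := exp_neg_half_log_le hμ hμ1
  -- Union bound bookkeeping: one unit of `c` pays for `δ`, and the surplus of `c` over the entropy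
  -- exponent `e` leaves `h ^ k`.
  have hexp : ∀ (k : ℕ) (c : ℝ), 1 ≤ c → ∀ e : ℝ, e + k / 2 ≤ c →
      Real.exp (v * (e * l)) * (2 * Real.exp (-(c * L))) ≤ 2 * h ^ k * δ := by
    intro k c hc e he
    have hδe : δ = Real.exp (-Real.log (1 / δ)) := by
      rw [Real.log_div one_ne_zero hδ.ne', Real.log_one, zero_sub, neg_neg, Real.exp_log hδ]
    have hR : 2 * h ^ k * δ = 2 * Real.exp (k * -(l / 2) + -Real.log (1 / δ)) := by
      rw [Real.exp_add, ← hδe, Real.exp_nat_mul, mul_assoc]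
    rw [hR, mul_left_comm, ← Real.exp_add]
    refine mul_le_mul_of_nonneg_left (Real.exp_le_exp.2 ?_) two_pos.le
    have h1 : Real.log (1 / δ) ≤ c * Real.log (1 / δ) := le_mul_of_one_le_left hlogδ.le hc
    have h2 : (k : ℝ) / 2 * l ≤ (c - e) * (v * l) :=
      mul_le_mul (by linarith) (le_mul_of_one_le_left hl.le hv1) hl.le
        ((by positivity : (0 : ℝ) ≤ k / 2).trans (by linarith))
    rw [hL_def]
    linarith
  have hqL : 60 * L ≤ q * (μ * ε ^ 2) := by
    rw [div_mul_eq_mul_div, div_le_iff₀ (by positivity)] at hq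
    exact hq
  have hB₀ : (uniformSample n q).real B₀ ≤ 2 * h ^ 1 * δ := by
    refine le_trans ?_ (hexp 1 2 (by norm_num) (3 / 2 + (0 : ℕ) / 2) (by norm_num))
    calc (uniformSample n q).real B₀
        ≤ ∑ p ∈ A 0, (uniformSample n q).real {C | ε / 2 * D p < |sampleDev C (φ p)|} :=
          measureReal_biUnion_finset_le _ _
      _ ≤ ∑ p ∈ A 0, 2 * Real.exp (-(2 * L)) := by
          refine Finset.sum_le_sum fun p hp => ?_
          have hpF := hAF 0 hp
          refine (uniformSample_bernstein hq0 (φ p) two_pos (by positivity) (by linarith)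
            (hφ0 p hpF) (hφ2 p hpF) (hmean p hpF)).trans ?_
          refine mul_le_mul_of_nonneg_left (Real.exp_le_exp.2 (neg_le_neg ?_)) two_pos.le
          -- The exponent is at least `60 * (3 / 56) * (5 / 8) * L`, barely above `2 * L`.
          have h1 : (q : ℝ) * ε ^ 2 * (5 / 8 * μ) ≤ q * ε ^ 2 * D p := by
            gcongr
            exact hD p hpF
          nlinarith
      _ = (A 0).card * (2 * Real.exp (-(2 * L))) := by rw [Finset.sum_const, nsmul_eq_mul]
      _ ≤ _ := by
          gcongr
          exact hcard 0
  have hB : ∀ j, (uniformSample n q).real (B j) ≤ 2 * h ^ (3 + 4 * j) * δ := by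
    intro j
    refine le_trans ?_ (hexp (3 + 4 * j) (7 / 2 + 5 / 2 * j) ?_ (3 / 2 + (j + 1 : ℕ) / 2) ?_)
    · calc (uniformSample n q).real (B j)
          ≤ ∑ p ∈ A (j + 1), (uniformSample n q).real
              {C | s j < |sampleDev C (fun i => φ p i - φ (π j p) i)|} :=
            measureReal_biUnion_finset_le _ _
        _ ≤ ∑ p ∈ A (j + 1), 2 * Real.exp (-((7 / 2 + 5 / 2 * j) * L)) := by
            refine Finset.sum_le_sum fun p hp => ?_
            have hpF := hAF _ hp
            obtain ⟨ha, hd, -⟩ := hπ j p hpF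
            refine (uniformSample_hoeffding hq0 (fun i => φ p i - φ (π j p) i)
              (B := 2 * η j) (mul_pos two_pos (hη j)) (hs j).le fun i => ?_).trans ?_
            · refine (hlip p hpF _ (hAF j ha) i).trans ?_
              gcongr
            refine mul_le_mul_of_nonneg_left (Real.exp_le_exp.2 (neg_le_neg ?_)) two_pos.le
            have e : s j ^ 2 / (2 * (2 * η j) ^ 2) =
                3125 / 864 / 60 * (16 / 9) ^ j * (μ * ε ^ 2) := by
              have e1 : (16 / 9 : ℝ) ^ j = ((2 / 3) ^ j) ^ 2 / ((1 / 2) ^ j) ^ 2 := by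
                rw [← pow_mul, ← pow_mul, mul_comm j, pow_mul, pow_mul, ← div_pow]
                norm_num
              have hp : (0 : ℝ) < (1 / 2) ^ j := by positivity
              rw [e1]
              simp only [s, η]
              rw [mul_pow, mul_pow (2 : ℝ), mul_pow _ ((1 / 2 : ℝ) ^ j), mul_pow (3 / 20 : ℝ), hsμ2]
              generalize ((1 / 2 : ℝ)) ^ j = x at *
              generalize ((2 / 3 : ℝ)) ^ j = y
              field_simp
              ring
            have hb : (1 : ℝ) + j * (7 / 9) ≤ (16 / 9) ^ j := by
              have := one_add_mul_le_pow (a := (7 / 9 : ℝ)) (by norm_num) j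
              norm_num at this ⊢
              exact this
            have hj : (0 : ℝ) ≤ j := j.cast_nonneg
            rw [e]
            calc (7 / 2 + 5 / 2 * (j : ℝ)) * L ≤ 3125 / 864 * (16 / 9) ^ j * L := by
                  gcongr
                  nlinarith
              _ = 3125 / 864 / 60 * (16 / 9) ^ j * (60 * L) := by ring
              _ ≤ 3125 / 864 / 60 * (16 / 9) ^ j * (q * (μ * ε ^ 2)) := by gcongr
              _ = _ := by ring
        _ = (A (j + 1)).card * (2 * Real.exp (-((7 / 2 + 5 / 2 * j) * L))) := by
            rw [Finset.sum_const, nsmul_eq_mul]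
        _ ≤ _ := by
            gcongr
            exact hcard (j + 1)
    · have hj : (0 : ℝ) ≤ j := j.cast_nonneg
      linarith
    · push_cast
      linarith
  have hgeo : ∑ j ∈ Finset.range J, 2 * h ^ (3 + 4 * j) * δ ≤ 0.16 * δ := by
    have h3 : h ^ 3 ≤ 0.41 ^ 3 := by gcongr
    have h4 : h ^ 4 ≤ 1 / 10 :=
      (pow_le_pow_left₀ hh0.le hh 4).trans (by norm_num)
    have hg : ∑ i ∈ Finset.range J, (1 / 10 : ℝ) ^ i ≤ 10 / 9 := by
      have := (summable_geometric_of_lt_one (r := (1 / 10 : ℝ)) (by norm_num)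
        (by norm_num)).sum_le_tsum (Finset.range J) fun _ _ => by positivity
      rw [tsum_geometric_of_lt_one (by norm_num) (by norm_num)] at this
      norm_num at this ⊢
      exact this
    calc ∑ j ∈ Finset.range J, 2 * h ^ (3 + 4 * j) * δ
        ≤ ∑ j ∈ Finset.range J, 2 * 0.41 ^ 3 * δ * (1 / 10) ^ j := by
          refine Finset.sum_le_sum fun j _ => ?_
          rw [pow_add, pow_mul, show 2 * (0.41 : ℝ) ^ 3 * δ * (1 / 10) ^ j =
            2 * (0.41 ^ 3 * (1 / 10) ^ j) * δ by ring]
          gcongr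
      _ = 2 * 0.41 ^ 3 * δ * ∑ j ∈ Finset.range J, (1 / 10 : ℝ) ^ j := by rw [Finset.mul_sum]
      _ ≤ 2 * 0.41 ^ 3 * δ * (10 / 9) := by gcongr
      _ ≤ 0.16 * δ := by
          norm_num
          linarith
  calc _ ≤ _ := measureReal_mono hsub
    _ ≤ _ := measureReal_union_le _ _
    _ ≤ 2 * h ^ 1 * δ + ∑ j ∈ Finset.range J, (uniformSample n q).real (B j) :=
        add_le_add hB₀ (measureReal_biUnion_finset_le _ _)
    _ ≤ 2 * 0.41 ^ 1 * δ + 0.16 * δ := by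
        refine add_le_add (by gcongr) ((Finset.sum_le_sum fun j _ => hB j).trans hgeo)
    _ ≤ δ := by
        norm_num
        linarith

/-! ### Homogenization of linear predictors -/

/-- Uniform relative deviation of the empirical loss of linear predictors. -/
theorem uniformSample_exists_loss_deviation_le {n d q : ℕ} [NeZero n] {ℓ : ℝ → ℝ}
    (hℓ : IsAdmissibleLoss ℓ) (a : Fin n → EuclideanSpace ℝ (Fin d)) (ha : ∀ i, ‖a i‖ ≤ 1)
    {μ ε δ : ℝ} (hμ : 0 < μ) (hμ1 : μ ≤ 1) (hε : 0 < ε) (hε1 : ε < 1) (hδ : 0 < δ) (hδ1 : δ < 1)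
    (hq : 60 / (μ * ε ^ 2) * ((d + 1) * Real.log (6 / μ) + Real.log (1 / δ)) ≤ q) :
    (uniformSample n q).real {C | ∃ b : EuclideanSpace ℝ (Fin d),
      ε * ((∑ i, ℓ (inner ℝ b (a i))) / n + μ * (‖b‖ ^ 2 / max 1 ‖b‖)) <
        |sampleDev C fun i => ℓ (inner ℝ b (a i))|} ≤ δ := by
  classical
  have hn : (0 : ℝ) < n := by exact_mod_cast Nat.pos_of_ne_zero (NeZero.ne n)
  let φ : EuclideanSpace ℝ (Fin d) × ℝ → Fin n → ℝ := fun w i => persp ℓ (inner ℝ w.1 (a i)) w.2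
  let D : EuclideanSpace ℝ (Fin d) × ℝ → ℝ := fun w => (∑ i, φ w i) / n + μ * ‖w.1‖ ^ 2
  let T : EuclideanSpace ℝ (Fin d) → EuclideanSpace ℝ (Fin d) × ℝ := fun b =>
    ((max 1 ‖b‖)⁻¹ • b, (max 1 ‖b‖)⁻¹)
  set Bad := {C : Fin q → Fin n | ∃ b : EuclideanSpace ℝ (Fin d),
      ε * ((∑ i, ℓ (inner ℝ b (a i))) / n + μ * (‖b‖ ^ 2 / max 1 ‖b‖)) <
        |sampleDev C fun i => ℓ (inner ℝ b (a i))|} with hBad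
  have hwit : ∀ C : Fin q → Fin n, ∃ b : EuclideanSpace ℝ (Fin d), C ∈ Bad →
      ε * ((∑ i, ℓ (inner ℝ b (a i))) / n + μ * (‖b‖ ^ 2 / max 1 ‖b‖)) <
        |sampleDev C fun i => ℓ (inner ℝ b (a i))| := by
    intro C
    by_cases hC : C ∈ Bad
    · obtain ⟨b, hb⟩ := hC
      exact ⟨b, fun _ => hb⟩
    · exact ⟨0, fun h => absurd h hC⟩
  choose b hb using hwit
  -- There are finitely many samples, so one violating `b` for each bad sample gives a finite
  -- parameter set.
  let F : Finset (EuclideanSpace ℝ (Fin d) × ℝ) := Finset.univ.image fun C => T (b C)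
  have hT : ∀ w ∈ F, 0 < w.2 ∧ w.2 ≤ 1 ∧ ‖w.1‖ ≤ 1 ∧ (w.2 = 1 ∨ ‖w.1‖ = 1) := by
    intro w hw
    obtain ⟨C, -, rfl⟩ := Finset.mem_image.1 hw
    have h1 : (1 : ℝ) ≤ max 1 ‖b C‖ := le_max_left _ _
    have h0 : (0 : ℝ) < max 1 ‖b C‖ := by linarith
    have hnorm : ‖(T (b C)).1‖ = (max 1 ‖b C‖)⁻¹ * ‖b C‖ := by
      simp only [T]
      rw [norm_smul, norm_inv, Real.norm_of_nonneg h0.le]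
    refine ⟨inv_pos.2 h0, inv_le_one_of_one_le₀ h1, ?_, ?_⟩
    · rw [hnorm, inv_mul_le_iff₀ h0, mul_one]
      exact le_max_right _ _
    · rcases le_total ‖b C‖ 1 with h | h
      · left
        simp [T, max_eq_left h]
      · right
        rw [hnorm, max_eq_right h, inv_mul_cancel₀ (by linarith)]
  have hinner : ∀ (w : EuclideanSpace ℝ (Fin d)) (i : Fin n), |inner ℝ w (a i)| ≤ ‖w‖ := by
    intro w i
    refine (abs_real_inner_le_norm w (a i)).trans ?_
    exact mul_le_of_le_one_right (norm_nonneg _) (ha i)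
  have hφ0 : ∀ w ∈ F, ∀ i, 0 ≤ φ w i := fun w hw i => hℓ.persp_nonneg _ (hT w hw).1
  have hrank : Module.finrank ℝ (EuclideanSpace ℝ (Fin d) × ℝ) = d + 1 := by
    rw [Module.finrank_prod, finrank_euclideanSpace_fin, Module.finrank_self]
  have main := uniformSample_exists_lt_abs_sampleDev_le (n := n) (q := q)
    (by rw [hrank]; omega) F φ D hμ hμ1 hε hε1 hδ hδ1 ?_ hφ0 ?_ ?_ ?_ ?_
    (by rw [hrank]; push_cast; exact hq)
  · refine (measureReal_mono ?_).trans main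
    intro C hC
    refine ⟨T (b C), Finset.mem_image_of_mem _ (Finset.mem_univ _), ?_⟩
    have hC' := hb C hC
    set t := max 1 ‖b C‖ with ht
    have h1 : (1 : ℝ) ≤ t := le_max_left _ _
    have h0 : (0 : ℝ) < t := by linarith
    have hφT : φ (T (b C)) = fun i => t⁻¹ * ℓ (inner ℝ (b C) (a i)) := by
      funext i
      simp only [φ, T, persp, ← ht]
      rw [real_inner_smul_left]
      congr 2
      field_simp
    have hdev : sampleDev C (φ (T (b C))) =
        t⁻¹ * sampleDev C fun i => ℓ (inner ℝ (b C) (a i)) := by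
      rw [hφT]
      simp only [sampleDev, ← Finset.mul_sum]
      ring
    have hDT : D (T (b C)) =
        t⁻¹ * ((∑ i, ℓ (inner ℝ (b C) (a i))) / n + μ * (‖b C‖ ^ 2 / t)) := by
      simp only [D]
      rw [hφT]
      simp only [T, ← ht]
      rw [norm_smul, norm_inv, Real.norm_of_nonneg h0.le, ← Finset.mul_sum]
      ring
    rw [hdev, hDT, abs_mul, abs_of_pos (inv_pos.2 h0), mul_left_comm]
    exact mul_lt_mul_of_pos_left hC' (inv_pos.2 h0)
  · intro w hw
    obtain ⟨h0, h1, h2, -⟩ := hT w hw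
    exact max_le h2 (by rwa [Real.norm_of_nonneg h0.le])
  · intro w hw i
    obtain ⟨h0, h1, h2, -⟩ := hT w hw
    exact hℓ.persp_le_two h0 h1 ((hinner _ i).trans h2)
  · intro w hw w' hw' i
    refine (hℓ.abs_persp_sub_le _ _ (hT w hw).1 (hT w' hw').1).trans ?_
    rw [← inner_sub_left, two_mul]
    refine add_le_add ((hinner _ i).trans ?_) ?_
    · rw [← dist_eq_norm]
      exact le_max_left _ _
    · rw [← Real.dist_eq]
      exact le_max_right _ _
  · intro w _
    exact le_add_of_nonneg_right (by positivity)
  · intro w hw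
    obtain ⟨h0, h1, h2, h3⟩ := hT w hw
    -- If the scale is `1`, the mean is at least `ℓ (-‖w.1‖)` and `neg_add_sq` applies, using `μ ≤
    -- 1`. Otherwise `‖w.1‖ = 1` and the quadratic term alone is `μ`.
    rcases h3 with h3 | h3
    · have hmean : ℓ (-‖w.1‖) ≤ (∑ i, φ w i) / n := by
        rw [le_div_iff₀ hn]
        calc ℓ (-‖w.1‖) * n = ∑ _i : Fin n, ℓ (-‖w.1‖) := by simp [mul_comm]
          _ ≤ ∑ i, φ w i := by
            refine Finset.sum_le_sum fun i _ => ?_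
            simp only [φ, persp, h3, one_mul, div_one]
            exact hℓ.mono (abs_le.1 (hinner w.1 i)).1
      have h4 := hℓ.neg_add_sq ‖w.1‖ (norm_nonneg _) h2
      have h5 := hℓ.nonneg (-‖w.1‖)
      have h6 := mul_le_mul_of_nonneg_left h4 hμ.le
      have h7 := mul_le_of_le_one_left h5 hμ1
      simp only [D]
      linarith
    · have : 0 ≤ (∑ i, φ w i) / n :=
        div_nonneg (Finset.sum_nonneg fun i _ => hφ0 w hw i) hn.le
      simp only [D]
      rw [h3]
      linarith

/-! ### Regularizers, coresets and the main theorem -/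

lemma norm_le_oneNorm {d : ℕ} (b : EuclideanSpace ℝ (Fin d)) : ‖b‖ ≤ oneNorm b := by
  rw [EuclideanSpace.norm_eq]
  refine Real.sqrt_le_iff.2 ⟨Finset.sum_nonneg fun _ _ => abs_nonneg _, ?_⟩
  simp only [Real.norm_eq_abs]
  exact Finset.sum_sq_le_sq_sum_of_nonneg fun _ _ => abs_nonneg _

/-- The left side is the minimum of `‖b‖` and `‖b‖ ^ 2`, hence a common lower bound. -/
lemma norm_sq_div_max_le_regularizer {d : ℕ} {r : EuclideanSpace ℝ (Fin d) → ℝ}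
    (hr : r = oneNorm ∨ r = twoNorm ∨ r = twoNormSq) (b : EuclideanSpace ℝ (Fin d)) :
    ‖b‖ ^ 2 / max 1 ‖b‖ ≤ r b := by
  have h1 : (1 : ℝ) ≤ max 1 ‖b‖ := le_max_left _ _
  have h0 : (0 : ℝ) < max 1 ‖b‖ := by linarith
  have hle : ‖b‖ ^ 2 / max 1 ‖b‖ ≤ ‖b‖ := by
    rw [div_le_iff₀ h0, sq]
    exact mul_le_mul_of_nonneg_left (le_max_right _ _) (norm_nonneg _)
  rcases hr with rfl | rfl | rfl
  · exact hle.trans (norm_le_oneNorm b)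
  · exact hle
  · exact div_le_self (by positivity) h1

lemma norm_le_maxNorm {n d : ℕ} (x : Fin n → EuclideanSpace ℝ (Fin d)) (i : Fin n) :
    ‖x i‖ ≤ maxNorm x :=
  le_ciSup (f := fun i => ‖x i‖) (Set.finite_range _).bddAbove i

/-- A deviation bound for the losses gives a coreset. -/
lemma isCoreset_of_abs_sampleDev_le {n d q : ℕ} [NeZero n] (hq : 0 < q) {ℓ : ℝ → ℝ}
    (hℓ : ∀ z, 0 ≤ ℓ z) {r : EuclideanSpace ℝ (Fin d) → ℝ} (hr : ∀ b, 0 ≤ r b)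
    {lam ε : ℝ} (hlam : 0 ≤ lam) (hε : 0 ≤ ε)
    (x : Fin n → EuclideanSpace ℝ (Fin d)) (y : Fin n → ℝ) (C : Fin q → Fin n)
    (h : ∀ β, |sampleDev C fun i => ℓ (-(y i) * inner ℝ β (x i))| ≤
      ε * ((∑ i, ℓ (-(y i) * inner ℝ β (x i))) / n + lam / n * r (maxNorm x • β))) :
    IsCoreset ℓ r lam x y ε C fun _ => (n : ℝ) / q := by
  have hn : (0 : ℝ) < n := by exact_mod_cast Nat.pos_of_ne_zero (NeZero.ne n)
  have hq' : (0 : ℝ) < q := by exact_mod_cast hq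
  refine ⟨fun _ => by positivity, fun β => ?_⟩
  have hsum : ∑ i, pointCost ℓ r lam x y i β = n *
      ((∑ i, ℓ (-(y i) * inner ℝ β (x i))) / n + lam / n * r (maxNorm x • β)) := by
    simp only [pointCost, Finset.sum_add_distrib, Finset.sum_const, Finset.card_univ,
      Fintype.card_fin, nsmul_eq_mul]
    field_simp
  have hdiff : ∑ i, pointCost ℓ r lam x y i β - ∑ k, (n : ℝ) / q * pointCost ℓ r lam x y (C k) β =
      -(n * sampleDev C fun i => ℓ (-(y i) * inner ℝ β (x i))) := by
    rw [hsum, ← Finset.mul_sum]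
    simp only [pointCost, Finset.sum_add_distrib, Finset.sum_const, Finset.card_univ,
      Fintype.card_fin, nsmul_eq_mul, sampleDev]
    field_simp
    ring
  refine div_le_of_le_mul₀ ?_ hε ?_
  · rw [hsum]
    have := Finset.sum_nonneg fun i (_ : i ∈ Finset.univ) => hℓ (-(y i) * inner ℝ β (x i))
    have := hr (maxNorm x • β)
    positivity
  · rw [hdiff, hsum, abs_neg, abs_mul, abs_of_pos hn, mul_left_comm]
    exact mul_le_mul_of_nonneg_left (h β) hn.le

end RLM

theorem mainTheorem2 {n d : ℕ} (hn : 0 < n)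
    (x : Fin n → EuclideanSpace ℝ (Fin d))
    (y : Fin n → ℝ) (hy : ∀ i, y i = -1 ∨ y i = 1)
    (ℓ : ℝ → ℝ) (hℓ : ℓ = RLM.logisticLoss ∨ ℓ = RLM.hingeLoss)
    (r : EuclideanSpace ℝ (Fin d) → ℝ)
    (hr : r = RLM.oneNorm ∨ r = RLM.twoNorm ∨ r = RLM.twoNormSq)
    (lam : ℝ) (hlam : 0 < lam)
    (S' : ℝ) (hS' : S' = 12 * n / lam + 6)
    (ε δ : ℝ) (hε : 0 < ε) (hε1 : ε < 1) (hδ : 0 < δ) (hδ1 : δ < 1) :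
    (∀ κ : ℝ, 0 < κ → κ < 1 → lam = (n : ℝ) ^ κ → S' = 12 * (n : ℝ) ^ (1 - κ) + 6) ∧
    ∀ q : ℕ, 10 * S' / ε ^ 2 * ((d + 1) * Real.log S' + Real.log (1 / δ)) ≤ q →
      1 - δ ≤ (RLM.uniformSample n q).real
        {C | RLM.IsCoreset ℓ r lam x y ε C (fun _ => (n : ℝ) / q)} := by
  have hn' : (0 : ℝ) < n := by exact_mod_cast hn
  have : NeZero n := ⟨hn.ne'⟩
  refine ⟨fun κ _ _ hκ => ?_, fun q hq => ?_⟩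
  · rw [hS', hκ, Real.rpow_sub hn', Real.rpow_one, mul_div_assoc]
  have hadm : RLM.IsAdmissibleLoss ℓ := by
    rcases hℓ with rfl | rfl
    exacts [RLM.isAdmissibleLoss_logisticLoss, RLM.isAdmissibleLoss_hingeLoss]
  have hreg := RLM.norm_sq_div_max_le_regularizer hr
  have hr0 : ∀ b, 0 ≤ r b := fun b => le_trans (by positivity) (hreg b)
  -- The cap at `1` serves the net and lower bounds; the summand `6` in `S'` pays for it.
  set μ := min (lam / n) 1 with hμ_def
  have hμ : 0 < μ := lt_min (by positivity) one_pos
  have hμ1 : μ ≤ 1 := min_le_right _ _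
  have hμlam : μ ≤ lam / n := min_le_left _ _
  have hSμ : 6 / μ ≤ S' := by
    have h0 : 0 < (n : ℝ) / lam := by positivity
    rw [hS', mul_div_assoc]
    rcases min_choice (lam / (n : ℝ)) 1 with h | h
    · rw [hμ_def, h, div_div_eq_mul_div, mul_div_assoc]
      linarith
    · rw [hμ_def, h]
      linarith
  have h6μ : 6 ≤ 6 / μ := by
    rw [le_div_iff₀ hμ]
    linarith
  have hlogμ : 0 < Real.log (6 / μ) := Real.log_pos (by linarith)
  have hlogδ : 0 < Real.log (1 / δ) := Real.log_pos (by rw [lt_div_iff₀ hδ]; linarith)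
  have hq' : 60 / (μ * ε ^ 2) * ((d + 1) * Real.log (6 / μ) + Real.log (1 / δ)) ≤ q := by
    refine le_trans ?_ hq
    rw [show 60 / (μ * ε ^ 2) = 10 * (6 / μ) / ε ^ 2 by field_simp; norm_num]
    have hS0 : 0 < S' := by linarith
    gcongr
  have hq0 : 0 < q := by
    have : (0 : ℝ) < q := lt_of_lt_of_le (by positivity) hq'
    exact_mod_cast this
  set R := RLM.maxNorm x with hR_def
  have hxR : ∀ i, ‖x i‖ ≤ R := RLM.norm_le_maxNorm x
  have hR0 : 0 ≤ R := (norm_nonneg _).trans (hxR ⟨0, hn⟩)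
  let a : Fin n → EuclideanSpace ℝ (Fin d) := fun i => (-(y i) / R) • x i
  have hy1 : ∀ i, |y i| = 1 := fun i => by rcases hy i with h | h <;> simp [h]
  have ha : ∀ i, ‖a i‖ ≤ 1 := by
    intro i
    simp only [a]
    rw [norm_smul, Real.norm_eq_abs, abs_div, abs_neg, hy1, abs_of_nonneg hR0,
      div_mul_eq_mul_div, one_mul]
    exact div_le_one_of_le₀ (hxR i) hR0
  have hinner : ∀ β i, inner ℝ (R • β) (a i) = -(y i) * inner ℝ β (x i) := by
    intro β i
    simp only [a]
    rw [real_inner_smul_left, real_inner_smul_right]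
    -- If `R = 0`, every `x i` vanishes and both sides are zero.
    rcases hR0.eq_or_lt with h | h
    · have hx0 : x i = 0 := norm_le_zero_iff.1 ((hxR i).trans_eq h.symm)
      simp [hx0]
    · field_simp
  have hbad := RLM.uniformSample_exists_loss_deviation_le (q := q) hadm a ha hμ hμ1 hε hε1 hδ hδ1 hq'
  set Bad := {C : Fin q → Fin n | ∃ b : EuclideanSpace ℝ (Fin d),
      ε * ((∑ i, ℓ (inner ℝ b (a i))) / n + μ * (‖b‖ ^ 2 / max 1 ‖b‖)) <
        |RLM.sampleDev C fun i => ℓ (inner ℝ b (a i))|} with hBad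
  calc 1 - δ ≤ 1 - (RLM.uniformSample n q).real Bad := by linarith
    _ = (RLM.uniformSample n q).real Badᶜ :=
        (probReal_compl_eq_one_sub (Set.toFinite Bad).measurableSet).symm
    _ ≤ _ := by
        refine measureReal_mono fun C hC => ?_
        refine RLM.isCoreset_of_abs_sampleDev_le hq0 hadm.nonneg hr0 hlam.le hε.le x y C fun β => ?_
        have h : ¬∃ b : EuclideanSpace ℝ (Fin d), _ := hC
        push Not at h
        have hβ := h (R • β)
        simp only [hinner] at hβ
        refine hβ.trans ?_
        gcongr
        exact hreg _
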